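/- Let $\mathbb{K}\in\{\mathbb{R},\mathbb{C}\}$, let $X,Y$ be Banach spaces over $\mathbb{K}$, let $N\in\mathbb{N}$, and let $T_{j,k}\colon X\to Y$ be a bounded linear operator for each $j\in\{1,\dots,N\}$ and $k\in\mathbb{N}$. Use the convention $1/0=\infty$ (so that each of the conditions below entails $T_{j,k}\neq 0$ for all $j,k$). Suppose that at least one of the following two conditions holds: (i) $\displaystyle\sum_{k=1}^{\infty}\frac{1}{\|T_{j,k}\|}<\infty$ for every $j\in\{1,\dots,N\}$; (ii) $\mathbb{K}=\mathbb{C}$, $X$ is a complex Hilbert space (with the norm induced by its inner product), and $\displaystyle\sum_{k=1}^{\infty}\frac{1}{\|T_{j,k}\|^{2}}<\infty$ for every $j\in\{1,\dots,N\}$. Then there exists $x\in X$ such that $\displaystyle\lim_{k\to\infty}\|T_{j,k}x\|_{Y}=\infty$ for every $j\in\{1,\dots,N\}$. -/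

import Mathlib

/-!
Both parts rest on plank theorems of Ball, which are proved here up to constants.

Attach to each `T j k` a weight `a j k * ‖T j k‖⁻¹` (respectively `√(a j k) * ‖T j k‖⁻¹`), where
`a j k → ∞` so slowly that the weights remain summable (respectively square summable). It then
suffices to find a single `x` with `‖T i x‖ ≥ const * weight i * ‖T i‖` for all `i : Fin N × ℕ`;
composing each `T i` with a functional that norms `T i` at an almost extremal vector reduces this
to functionals `φ i` on `X`.

*Banach spaces.* Let `x i` be almost norming for `φ i` and `∑ p i < ∞`. The vectors
`∑ j, √(p j) * ν j • x j` with `ν` in `ℓ²` turn the problem into one about vectors `u i` of `ℓ²`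
with `⟪u i, e i⟫ ≥ 1` for an orthonormal family `e`: find `ν` with `|⟪u i, ν⟫| ≥ √(p i) / 2`.
Bounded balls of `ℓ²` are weakly compact, so finitely many `u i` may be treated at a time.
For these, let `v` minimise `∑ i, exp (-q * ⟪u i, v i⟫)` over all orthonormal families. The
comparison with `e` gives `⟪u i, v i⟫ ≥ 1 / 2` if `q` is large, and stationarity under plane
rotations says exactly that the matrix `⟪u i, v j⟫` becomes symmetric after its rows are multiplied
by positive numbers (`exists_orthonormal_weighted_symm`). For a symmetric matrix, Bang's choice of
signs (`Matrix.IsSymm.exists_signs`), which maximises a quadratic form, gives the required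
`ν = ∑ j, ± √(p j) • v j`.

*Complex Hilbert spaces.* For unit vectors `v i` and natural weights `n i` with sum `M`, let `z`
maximise `∏ i, ‖⟪v i, z⟫‖ ^ n i` on the unit sphere. Along the circles `‖⟪v k, z + α • v k⟫‖ = r`
both `‖z + α • v k‖` and the `k`-th factor are constant, while the remaining product is the absolute
value of a polynomial in `α`, to which the maximum modulus principle applies once `r > ‖⟪v k, z⟫‖`. Letting
`r` decrease to `‖⟪v k, z⟫‖` yields `n k ≤ M * ‖⟪v k, z⟫‖ ^ 2` (`weight_le_mul_norm_inner_sq_of_isMaxOn`).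
Rational approximation of the weights and weak compactness finish the argument.
-/

open scoped RealInnerProductSpace

/-! ### Slowly growing multipliers of a convergent series -/

/-- Dividing the terms of a convergent positive series by the square roots of its tails leaves it
convergent, by comparison with a telescoping sum. -/
theorem exists_tendsto_atTop_summable_mul {b : ℕ → ℝ} (hb : ∀ k, 0 < b k) (hs : Summable b) :
    ∃ a : ℕ → ℝ, (∀ k, 0 < a k) ∧ Filter.Tendsto a Filter.atTop Filter.atTop ∧
      Summable fun k => a k * b k := by
  set R : ℕ → ℝ := fun k => ∑' i, b (i + k) with hR
  have hsk : ∀ k, Summable fun i => b (i + k) := fun k => (summable_nat_add_iff k).2 hs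
  have hRpos : ∀ k, 0 < R k := fun k => (hsk k).tsum_pos (fun i => (hb _).le) 0 (hb _)
  have hRsucc : ∀ k, R k = b k + R (k + 1) := by
    intro k
    have h := (hsk k).tsum_eq_zero_add
    simp only [hR, h, zero_add]
    congr 1
    exact tsum_congr fun i => by congr 1; ring
  have hR0 : Filter.Tendsto R Filter.atTop (nhds 0) := tendsto_sum_nat_add b
  refine ⟨fun k => (√(R k))⁻¹, fun k => inv_pos.2 (Real.sqrt_pos.2 (hRpos k)), ?_, ?_⟩
  · apply Filter.Tendsto.inv_tendsto_nhdsGT_zero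
    refine tendsto_nhdsWithin_iff.2 ⟨?_, Filter.Eventually.of_forall fun k =>
      Real.sqrt_pos.2 (hRpos k)⟩
    simpa using hR0.sqrt
  · have key : ∀ k, (√(R k))⁻¹ * b k ≤ 2 * (√(R k) - √(R (k + 1))) := by
      intro k
      have h1 := Real.sqrt_pos.2 (hRpos k)
      have h2 := Real.sqrt_pos.2 (hRpos (k + 1))
      have h3 := Real.sq_sqrt (hRpos k).le
      have h4 := Real.sq_sqrt (hRpos (k + 1)).le
      rw [inv_mul_le_iff₀ h1]
      nlinarith [sq_nonneg (√(R k) - √(R (k + 1))), hRsucc k]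
    refine summable_of_sum_range_le (c := 2 * √(R 0))
      (fun k => mul_nonneg (inv_nonneg.2 (Real.sqrt_nonneg _)) (hb k).le) fun n => ?_
    calc ∑ k ∈ Finset.range n, (√(R k))⁻¹ * b k
        ≤ ∑ k ∈ Finset.range n, 2 * (√(R k) - √(R (k + 1))) :=
          Finset.sum_le_sum fun k _ => key k
      _ = 2 * (√(R 0) - √(R n)) := by
          rw [← Finset.mul_sum, Finset.sum_range_sub']
      _ ≤ 2 * √(R 0) := by linarith [Real.sqrt_nonneg (R n)]

/-! ### Symmetrisation by the choice of an orthonormal family -/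

theorem isCompact_setOf_orthonormal {ι E : Type*} [Fintype ι] [NormedAddCommGroup E]
    [InnerProductSpace ℝ E] [FiniteDimensional ℝ E] :
    IsCompact {v : ι → E | Orthonormal ℝ v} := by
  classical
  have : ProperSpace E := FiniteDimensional.proper_real E
  refine (isCompact_closedBall (0 : ι → E) 1).of_isClosed_subset ?_ ?_
  · simp only [orthonormal_iff_ite, Set.ofPred_forall]
    exact isClosed_iInter fun i => isClosed_iInter fun j =>
      isClosed_eq (by fun_prop) continuous_const
  · intro v hv
    rw [mem_closedBall_zero_iff, pi_norm_le_iff_of_nonneg zero_le_one]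
    exact fun i => (hv.1 i).le

/-- Rotating two members of an orthonormal family by an angle `θ` in the plane they span. The family
is written as a perturbation of `v` so that its derivative at `θ = 0` can be read off. -/
theorem Orthonormal.rotate {ι E : Type*} [DecidableEq ι] [NormedAddCommGroup E]
    [InnerProductSpace ℝ E] {v : ι → E} (hv : Orthonormal ℝ v) {i j : ι} (hij : i ≠ j) (θ : ℝ) :
    Orthonormal ℝ fun k => v k +
      ((Real.cos θ - 1) • (if k = i then v i else if k = j then v j else 0) +
        Real.sin θ • (if k = i then v j else if k = j then -v i else 0)) := by
  have hn := hv.1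
  rw [orthonormal_iff_ite] at hv ⊢
  have hcs := Real.sin_sq_add_cos_sq θ
  have hji := hij.symm
  intro a b
  by_cases hai : a = i
  · subst hai
    by_cases hbi : b = a
    · subst hbi
      simp only [↓reduceIte, inner_add_left, inner_add_right, inner_smul_left, inner_smul_right,
        hv, hij, hji, conj_trivial]
      linarith
    by_cases hbj : b = j
    · subst hbj
      simp [inner_add_left, inner_add_right, inner_smul_left, inner_smul_right, hv, hn, hij, hji]
      ring
    simp [inner_add_left, inner_smul_left, hv, hbi, hbj, Ne.symm hbi, Ne.symm hbj]
  by_cases haj : a = j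
  · subst haj
    by_cases hbi : b = i
    · subst hbi
      simp [inner_add_left, inner_add_right, inner_smul_left, inner_smul_right, hv, hn, hij, hji]
      ring
    by_cases hbj : b = a
    · subst hbj
      simp only [↓reduceIte, inner_add_left, inner_add_right, inner_smul_left, inner_smul_right,
        inner_neg_left, inner_neg_right, hv, hij, hji, conj_trivial]
      linarith
    simp [inner_add_left, inner_smul_left, hv, hai, hbi, hbj, Ne.symm hbi, Ne.symm hbj]
  by_cases hbi : b = i
  · subst hbi
    simp [inner_add_right, inner_smul_right, hv, hai, haj]
  by_cases hbj : b = j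
  · subst hbj
    simp [inner_add_right, inner_smul_right, hv, hai, haj, hji]
  simp [hv, hai, haj, hbi, hbj]

/-- The family `v` minimises `∑ i, exp (-p * ⟪u i, v i⟫)`, a smooth substitute for maximising the
smallest of the `⟪u i, v i⟫`; the row weights `c i` are the summands at the minimum. -/
theorem exists_orthonormal_weighted_symm {ι E : Type*} [Fintype ι] [NormedAddCommGroup E]
    [InnerProductSpace ℝ E] [FiniteDimensional ℝ E] {u e : ι → E} (he : Orthonormal ℝ e)
    (hue : ∀ i, 1 ≤ ⟪u i, e i⟫) :
    ∃ (v : ι → E) (c : ι → ℝ), Orthonormal ℝ v ∧ (∀ i, 0 < c i) ∧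
      (∀ i j, c i * ⟪u i, v j⟫ = c j * ⟪u j, v i⟫) ∧ ∀ i, 1 / 2 ≤ ⟪u i, v i⟫ := by
  classical
  set n : ℝ := ((Fintype.card ι : ℕ) : ℝ) with hn
  have hn0 : 0 ≤ n := Nat.cast_nonneg _
  have hlog : 0 ≤ Real.log (n + 1) := Real.log_nonneg (by linarith)
  -- For this `p` one has `card ι * exp (-p) ≤ exp (-p / 2)`.
  set p : ℝ := 2 * Real.log (n + 1) + 1 with hp
  have hp0 : 0 < p := by linarith
  obtain ⟨v, hv, hmin⟩ := (isCompact_setOf_orthonormal (ι := ι) (E := E)).exists_isMinOn ⟨e, he⟩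
    (f := fun v : ι → E => ∑ k, Real.exp (-p * ⟪u k, v k⟫)) (by fun_prop)
  refine ⟨v, fun i => Real.exp (-p * ⟪u i, v i⟫), hv, fun i => Real.exp_pos _, fun i j => ?_,
    fun i => ?_⟩
  · rcases eq_or_ne i j with rfl | hij
    · rfl
    set A : ι → E := fun k => if k = i then v i else if k = j then v j else 0 with hA
    set B : ι → E := fun k => if k = i then v j else if k = j then -v i else 0 with hB
    have hloc : IsLocalMin (fun θ : ℝ => ∑ k, Real.exp (-p * (⟪u k, v k⟫ +
        ((Real.cos θ - 1) * ⟪u k, A k⟫ + Real.sin θ * ⟪u k, B k⟫)))) 0 := by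
      refine Filter.Eventually.of_forall fun θ => ?_
      have h := hmin (Orthonormal.rotate hv hij θ)
      simp only [Set.mem_ofPred_eq, inner_add_right, inner_smul_right] at h
      simpa [A, B] using h
    have hder : HasDerivAt (fun θ : ℝ => ∑ k, Real.exp (-p * (⟪u k, v k⟫ +
        ((Real.cos θ - 1) * ⟪u k, A k⟫ + Real.sin θ * ⟪u k, B k⟫))))
        (∑ k, Real.exp (-p * ⟪u k, v k⟫) * (-p * ⟪u k, B k⟫)) 0 := by
      refine HasDerivAt.fun_sum fun k _ => ?_
      have h := (((((Real.hasDerivAt_cos 0).sub_const 1).mul_const ⟪u k, A k⟫).add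
        ((Real.hasDerivAt_sin 0).mul_const ⟪u k, B k⟫)).const_add ⟪u k, v k⟫).const_mul (-p)
      exact h.exp.congr_deriv (by simp)
    have h0 := hloc.hasDerivAt_eq_zero hder
    have hsum : ∑ k, Real.exp (-p * ⟪u k, v k⟫) * (-p * ⟪u k, B k⟫) =
        -p * (Real.exp (-p * ⟪u i, v i⟫) * ⟪u i, v j⟫ -
          Real.exp (-p * ⟪u j, v j⟫) * ⟪u j, v i⟫) := by
      rw [Fintype.sum_eq_add i j hij]
      · simp [B, hij.symm]
        ring
      · rintro k ⟨hki, hkj⟩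
        simp [B, hki, hkj]
    rw [hsum] at h0
    have := (mul_eq_zero.1 h0).resolve_left (by linarith)
    linarith
  · have h1 : Real.exp (-p * ⟪u i, v i⟫) ≤ ∑ k, Real.exp (-p * ⟪u k, v k⟫) :=
      Finset.single_le_sum (f := fun k => Real.exp (-p * ⟪u k, v k⟫))
        (fun k _ => (Real.exp_pos _).le) (Finset.mem_univ i)
    have h2 : ∑ k, Real.exp (-p * ⟪u k, v k⟫) ≤ ∑ k, Real.exp (-p * ⟪u k, e k⟫) := hmin he
    have h3 : ∑ k, Real.exp (-p * ⟪u k, e k⟫) ≤ ∑ _k : ι, Real.exp (-p) := by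
      refine Finset.sum_le_sum fun k _ => Real.exp_le_exp.2 ?_
      nlinarith [hue k]
    have h4 : ∑ _k : ι, Real.exp (-p) ≤ Real.exp (Real.log (n + 1) - p) := by
      rw [sub_eq_add_neg, Real.exp_add, Real.exp_log (by linarith)]
      simp only [Finset.sum_const, Finset.card_univ, nsmul_eq_mul]
      nlinarith [Real.exp_pos (-p)]
    have h5 := Real.exp_le_exp.1 (h1.trans (h2.trans (h3.trans h4)))
    nlinarith

/-! ### Planks in real Hilbert spaces -/

open Matrix in
/-- **Bang's lemma**: among the sign choices `x i = ± s i`, take one that maximises the quadratic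
form of `H`; comparing it with the choice in which the `k`-th sign is flipped gives the bound. -/
theorem Matrix.IsSymm.exists_signs {ι : Type*} [Fintype ι] {H : Matrix ι ι ℝ} (hH : H.IsSymm)
    (s : ι → ℝ) :
    ∃ x : ι → ℝ, (∀ i, x i = s i ∨ x i = -s i) ∧ ∀ k, H k k * |s k| ≤ |(H *ᵥ x) k| := by
  classical
  have hfin : {x : ι → ℝ | ∀ i, x i ∈ ({s i, -s i} : Set ℝ)}.Finite :=
    Set.Finite.pi' fun i => Set.toFinite _
  obtain ⟨x, hx, hmax⟩ := Set.exists_max_image _ (fun x => x ⬝ᵥ H *ᵥ x) hfin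
    ⟨s, fun i => Or.inl rfl⟩
  replace hx : ∀ i, x i = s i ∨ x i = -s i := hx
  refine ⟨x, hx, fun k => ?_⟩
  have hflip := hmax (x + Pi.single k (-2 * x k)) (by
    intro i
    rcases eq_or_ne i k with rfl | hik
    · have h2 : (x + Pi.single i (-2 * x i) : ι → ℝ) i = -x i := by simp; ring
      rw [h2]
      rcases hx i with h | h
      · exact Or.inr (congrArg Neg.neg h)
      · exact Or.inl (neg_eq_iff_eq_neg.2 h)
    · simpa [hik] using hx i)
  have hsym : x ⬝ᵥ H *ᵥ Pi.single k (-2 * x k) = -2 * x k * (H *ᵥ x) k := by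
    rw [dotProduct_mulVec, ← mulVec_transpose, hH.eq, dotProduct_single, mul_comm]
  have habs : |x k| = |s k| := by rcases hx k with h | h <;> simp [h]
  have hkey : H k k * (x k * x k) ≤ x k * (H *ᵥ x) k := by
    simp only [mulVec_add, dotProduct_add, add_dotProduct, hsym, single_dotProduct] at hflip
    simp at hflip
    linarith
  rw [← habs]
  rcases eq_or_ne (x k) 0 with h0 | h0
  · simp [h0]
  · refine le_of_mul_le_mul_left ?_ (abs_pos.2 h0)
    calc |x k| * (H k k * |x k|) = H k k * (x k * x k) := by
          rw [← abs_mul_abs_self (x k)]; ring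
      _ ≤ x k * (H *ᵥ x) k := hkey
      _ ≤ |x k| * |(H *ᵥ x) k| := by rw [← abs_mul]; exact le_abs_self _

/-- A real plank theorem for finitely many vectors. The vectors `u i` need not be of norm one; it is
their position relative to an orthonormal family that matters. -/
theorem Orthonormal.exists_norm_sq_eq_and_half_le_abs_inner {ι E : Type*} [Fintype ι]
    [NormedAddCommGroup E] [InnerProductSpace ℝ E] [FiniteDimensional ℝ E] {u e : ι → E}
    (he : Orthonormal ℝ e) (hue : ∀ i, 1 ≤ ⟪u i, e i⟫) (s : ι → ℝ) :
    ∃ z : E, ‖z‖ ^ 2 = ∑ i, s i ^ 2 ∧ ∀ i, s i / 2 ≤ |⟪u i, z⟫| := by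
  obtain ⟨v, c, hv, hc, hsymm, hdiag⟩ := exists_orthonormal_weighted_symm he hue
  obtain ⟨x, hx, hle⟩ := Matrix.IsSymm.exists_signs
    (H := Matrix.of fun i j => c i * ⟪u i, v j⟫) (Matrix.IsSymm.ext fun i j => hsymm j i) s
  refine ⟨∑ j, x j • v j, ?_, fun i => ?_⟩
  · rw [← real_inner_self_eq_norm_sq, hv.inner_sum]
    refine Finset.sum_congr rfl fun i _ => ?_
    rcases hx i with h | h <;> simp [h, sq]
  · have h := hle i
    have hsum : (Matrix.mulVec (Matrix.of fun i j => c i * ⟪u i, v j⟫) x) i =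
        c i * ⟪u i, ∑ j, x j • v j⟫ := by
      simp only [Matrix.mulVec, dotProduct, Matrix.of_apply, inner_sum, inner_smul_right,
        Finset.mul_sum]
      exact Finset.sum_congr rfl fun j _ => by ring
    rw [hsum, abs_mul, abs_of_pos (hc i), Matrix.of_apply, mul_assoc] at h
    have h' := le_of_mul_le_mul_left h (hc i)
    nlinarith [le_abs_self (s i), abs_nonneg (s i), hdiag i]

/-- Lower bounds for coefficients that can be met in a fixed ball for every finite set of indices
can be met for all indices at once, by weak compactness of the ball. -/
theorem exists_le_norm_inner_of_finset {𝕜 ι H : Type*} [RCLike 𝕜] [NormedAddCommGroup H]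
    [InnerProductSpace 𝕜 H] [CompleteSpace H] (u : ι → H) (t : ι → ℝ) (C : ℝ)
    (h : ∀ F : Finset ι, ∃ z : H, ‖z‖ ≤ C ∧ ∀ i ∈ F, t i ≤ ‖inner 𝕜 (u i) z‖) :
    ∃ z : H, ‖z‖ ≤ C ∧ ∀ i, t i ≤ ‖inner 𝕜 (u i) z‖ := by
  have hcomp := WeakDual.isCompact_closedBall (0 : StrongDual 𝕜 H) C
  have hne := hcomp.inter_iInter_nonempty (fun i => {f : WeakDual 𝕜 H | t i ≤ ‖f (u i)‖})
    (fun i => isClosed_le continuous_const (WeakDual.eval_continuous (u i)).norm) (by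
      intro F
      obtain ⟨z, hz, hF⟩ := h F
      refine ⟨StrongDual.toWeakDual (InnerProductSpace.toDual 𝕜 H z), ?_, ?_⟩
      · simpa using hz
      · simp only [Set.mem_iInter, Set.mem_ofPred_eq]
        intro i hi
        rw [StrongDual.toWeakDual_apply, InnerProductSpace.toDual_apply_apply, norm_inner_symm]
        exact hF i hi)
  obtain ⟨f, hf, hfi⟩ := hne
  refine ⟨(InnerProductSpace.toDual 𝕜 H).symm (WeakDual.toStrongDual f), ?_, fun i => ?_⟩
  · simpa using hf
  · rw [norm_inner_symm, InnerProductSpace.toDual_symm_apply]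
    exact Set.mem_iInter.1 hfi i

/-- The real plank theorem for an arbitrary family, with square summable widths. -/
theorem Orthonormal.exists_half_le_abs_inner {ι H : Type*} [NormedAddCommGroup H]
    [InnerProductSpace ℝ H] [CompleteSpace H] {u e : ι → H} (he : Orthonormal ℝ e)
    (hue : ∀ i, 1 ≤ ⟪u i, e i⟫) {s : ι → ℝ} (hs : Summable fun i => s i ^ 2) :
    ∃ z : H, ∀ i, s i / 2 ≤ |⟪u i, z⟫| := by
  obtain ⟨z, -, hz⟩ := exists_le_norm_inner_of_finset (𝕜 := ℝ) u (fun i => s i / 2)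
    (√(∑' i, s i ^ 2)) (by
      intro F
      let E : Submodule ℝ H := Submodule.span ℝ (e '' F)
      have : FiniteDimensional ℝ E := FiniteDimensional.span_of_finite ℝ (F.finite_toSet.image e)
      have heE : ∀ i : F, e i ∈ E := fun i => Submodule.subset_span ⟨i, i.2, rfl⟩
      obtain ⟨z, hz, hzF⟩ := Orthonormal.exists_norm_sq_eq_and_half_le_abs_inner (ι := F) (E := E)
        (u := fun i => E.orthogonalProjectionOnto (u i)) (e := fun i => ⟨e i, heE i⟩)
        ((he.comp _ Subtype.val_injective).codRestrict E heE)
        (fun i => by simpa using hue i) (fun i => s i)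
      refine ⟨z, Real.le_sqrt_of_sq_le ?_, fun i hi => ?_⟩
      · rw [← Submodule.coe_norm, hz, Finset.sum_coe_sort F fun i => s i ^ 2]
        exact hs.sum_le_tsum F fun i _ => sq_nonneg _
      · simpa using hzF ⟨i, hi⟩)
  exact ⟨z, hz⟩

/-! ### Planks in complex Hilbert spaces -/

/-- The first-order comparison at `0` of the two sides. -/
theorem le_of_forall_one_add_mul_le_exp {a b : ℝ} (hb : 0 < b)
    (h : ∀ τ : ℝ, 0 < τ → 1 + a * τ ≤ Real.exp (b * τ)) : a ≤ b := by
  by_contra! hab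
  have ha : 0 < a := hb.trans hab
  -- With this `τ`, the inequality `(1 + a * τ) * (1 - b * τ) ≤ 1` reads `a - b ≤ (a - b) / 2`.
  set τ := (a - b) / (2 * a * b) with hτ
  have hτ0 : 0 < τ := div_pos (by linarith) (by positivity)
  have hτe : 2 * (a * b * τ) = a - b := by rw [hτ]; field_simp
  have h1 := h τ hτ0
  have h2 : 1 - b * τ ≤ Real.exp (-(b * τ)) := Real.one_sub_le_exp_neg _
  have h3 : Real.exp (b * τ) * Real.exp (-(b * τ)) = 1 := by rw [← Real.exp_add]; simp
  have h4 : (1 + a * τ) * (1 - b * τ) ≤ 1 := by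
    calc (1 + a * τ) * (1 - b * τ) ≤ (1 + a * τ) * Real.exp (-(b * τ)) := by gcongr
      _ ≤ Real.exp (b * τ) * Real.exp (-(b * τ)) := by gcongr
      _ = 1 := h3
  nlinarith

/-- If `z` maximises the weighted product of the `‖⟪v i, z⟫‖` on the unit sphere, then every factor
is bounded below in terms of its own weight. The hypothesis `hmax` is the homogeneous form of
maximality. -/
theorem weight_le_mul_norm_inner_sq_of_isMaxOn {ι E : Type*} [Fintype ι] [NormedAddCommGroup E]
    [InnerProductSpace ℂ E] {v : ι → E} (hv : ∀ i, ‖v i‖ = 1) {n : ι → ℕ} {z : E} (hz : ‖z‖ = 1)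
    (hz0 : ∀ i, inner ℂ (v i) z ≠ 0)
    (hmax : ∀ y : E, ∏ i, ‖inner ℂ (v i) y‖ ^ n i ≤
      (∏ i, ‖inner ℂ (v i) z‖ ^ n i) * ‖y‖ ^ ∑ i, n i) (k : ι) :
    (n k : ℝ) ≤ (∑ i, n i : ℕ) * ‖inner ℂ (v k) z‖ ^ 2 := by
  classical
  set M := ∑ i, n i with hM
  have hnM : n k ≤ M := Finset.single_le_sum (fun _ _ => Nat.zero_le _) (Finset.mem_univ k)
  rcases Nat.eq_zero_or_pos M with hM0 | hM0
  · have : n k = 0 := by omega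
    simp [this, hM0]
  set y : ℂ := inner ℂ (v k) z with hy
  set q : ℝ := ‖y‖ ^ 2 with hq
  have hy0 : 0 < ‖y‖ := norm_pos_iff.2 (hz0 k)
  have hq0 : 0 < q := by positivity
  -- The factors other than the `k`-th form a polynomial in the displacement `α` along `v k`.
  set g : ℂ → ℂ := fun α => ∏ i ∈ Finset.univ.erase k, (inner ℂ (v i) (z + α • v k)) ^ n i with hg
  have hgdiff : Differentiable ℂ g := by
    simp only [hg, inner_add_right, inner_smul_right]
    fun_prop
  have hg0 : 0 < ‖g 0‖ := by
    simp only [hg, zero_smul, add_zero, norm_prod, norm_pow]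
    exact Finset.prod_pos fun i _ => pow_pos (norm_pos_iff.2 (hz0 i)) _
  have hprod : ∀ α : ℂ, ∏ i, ‖inner ℂ (v i) (z + α • v k)‖ ^ n i = ‖y + α‖ ^ n k * ‖g α‖ := by
    intro α
    rw [← Finset.mul_prod_erase _ _ (Finset.mem_univ k)]
    simp only [hg, norm_prod, norm_pow]
    congr 3
    rw [inner_add_right, inner_smul_right, inner_self_eq_norm_sq_to_K, hv k]
    simp [hy]
  have hnorm : ∀ α : ℂ, ‖z + α • v k‖ ^ 2 = 1 - q + ‖y + α‖ ^ 2 := by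
    intro α
    have h1 : ‖z + α • v k‖ ^ 2 = 1 + 2 * (α * starRingEnd ℂ y).re + ‖α‖ ^ 2 := by
      rw [@norm_add_sq ℂ, hz, norm_smul, hv k, inner_smul_right, ← inner_conj_symm]
      simp [hy]
    rw [h1, hq, ← Complex.normSq_eq_norm_sq, ← Complex.normSq_eq_norm_sq,
      ← Complex.normSq_eq_norm_sq, Complex.normSq_add]
    simp
    ring
  -- Comparison of `z` with a point of the circle `‖y + α‖ ^ 2 = q + τ` at which `‖g α‖ ≥ ‖g 0‖`;
  -- such a point exists because `0` lies inside the circle.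
  have hstep : ∀ τ : ℝ, 0 < τ → 1 + (n k / q) * τ ≤ Real.exp (M * τ) := by
    intro τ hτ
    set r : ℝ := √(q + τ) with hr
    have hr2 : r ^ 2 = q + τ := Real.sq_sqrt (by positivity)
    have hr0 : 0 < r := Real.sqrt_pos.2 (by positivity)
    have hyr : ‖y‖ < r := by
      rw [hr]; exact Real.lt_sqrt_of_sq_lt (by rw [← hq]; linarith)
    obtain ⟨α, hα, hαmax⟩ := Complex.exists_mem_frontier_isMaxOn_norm
      (f := g) (U := Metric.ball (-y) r) Metric.isBounded_ball ⟨-y, Metric.mem_ball_self hr0⟩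
      hgdiff.diffContOnCl
    rw [frontier_ball _ hr0.ne', mem_sphere_iff_norm, sub_neg_eq_add, add_comm] at hα
    have hgα : ‖g 0‖ ≤ ‖g α‖ := hαmax (subset_closure (by simpa using hyr))
    have h1 := hmax (z + α • v k)
    have h0 := hprod 0
    simp only [zero_smul, add_zero] at h0
    rw [hprod, h0, hα] at h1
    have h2 : r ^ n k ≤ ‖y‖ ^ n k * ‖z + α • v k‖ ^ M := by
      refine le_of_mul_le_mul_right ?_ hg0
      calc r ^ n k * ‖g 0‖ ≤ r ^ n k * ‖g α‖ := by gcongr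
        _ ≤ _ := by linarith
    have h3 : (q + τ) ^ n k ≤ q ^ n k * (1 + τ) ^ M := by
      have h := pow_le_pow_left₀ (by positivity) h2 2
      rw [mul_pow, ← pow_mul, ← pow_mul, ← pow_mul, mul_comm (n k), mul_comm M, pow_mul, pow_mul,
        pow_mul, hr2, hnorm, hα, hr2] at h
      have h1τ : 1 - q + (q + τ) = 1 + τ := by ring
      rwa [h1τ, ← hq] at h
    have h4 : (1 + τ / q) ^ n k ≤ (1 + τ) ^ M := by
      have : (q + τ) = q * (1 + τ / q) := by field_simp
      rw [this, mul_pow] at h3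
      exact le_of_mul_le_mul_left h3 (by positivity)
    calc 1 + (n k / q) * τ = 1 + n k * (τ / q) := by ring
      _ ≤ (1 + τ / q) ^ n k :=
        one_add_mul_le_pow (by linarith [div_pos hτ hq0]) _
      _ ≤ (1 + τ) ^ M := h4
      _ ≤ Real.exp τ ^ M := by gcongr; linarith [Real.add_one_le_exp τ]
      _ = Real.exp (M * τ) := by rw [← Real.exp_nat_mul]
  have := le_of_forall_one_add_mul_le_exp (by exact_mod_cast hM0) hstep
  rwa [div_le_iff₀ hq0] at this

/-- Positivity of the weights makes the product vanish as soon as one of the inner products does, so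
that a maximiser is orthogonal to none of the `v i`. -/
theorem exists_weight_le_mul_norm_inner_sq {ι E : Type*} [Fintype ι] [Nonempty ι]
    [NormedAddCommGroup E] [InnerProductSpace ℂ E] [FiniteDimensional ℂ E] {v : ι → E}
    (hv : ∀ i, ‖v i‖ = 1) {n : ι → ℕ} (hn : ∀ i, 0 < n i) :
    ∃ z : E, ‖z‖ = 1 ∧ ∀ i, (n i : ℝ) ≤ (∑ i, n i : ℕ) * ‖inner ℂ (v i) z‖ ^ 2 := by
  have : ProperSpace E := FiniteDimensional.proper ℂ E
  obtain ⟨z, hz, hmax⟩ := (isCompact_sphere (0 : E) 1).exists_isMaxOn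
    ⟨v (Classical.arbitrary ι), by simp [hv]⟩
    (f := fun z => ∏ i, ‖inner ℂ (v i) z‖ ^ n i) (by fun_prop)
  have hmax' : ∀ y : E, ∏ i, ‖inner ℂ (v i) y‖ ^ n i ≤
      (∏ i, ‖inner ℂ (v i) z‖ ^ n i) * ‖y‖ ^ ∑ i, n i := by
    intro y
    rcases eq_or_ne y 0 with rfl | hy
    · have h0 : ∏ i, ‖inner ℂ (v i) (0 : E)‖ ^ n i = 0 :=
        Finset.prod_eq_zero (Finset.mem_univ (Classical.arbitrary ι)) (by simp [(hn _).ne'])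
      rw [h0]
      positivity
    · have hy0 : 0 < ‖y‖ := norm_pos_iff.2 hy
      have h := hmax (a := (‖y‖⁻¹ : ℂ) • y) (by simp [norm_smul, hy0.ne'])
      simp only [inner_smul_right, norm_mul, mul_pow, Finset.prod_mul_distrib,
        norm_inv, Complex.norm_real, norm_norm, inv_pow,
        Set.mem_ofPred_eq, Finset.prod_inv_distrib,
        Finset.prod_pow_eq_pow_sum] at h
      rwa [inv_mul_le_iff₀ (by positivity), mul_comm] at h
  obtain ⟨x, hx⟩ := Module.Dual.exists_forall_ne_zero_of_forall_exists
    (fun i => (innerSL ℂ (v i) : E →ₗ[ℂ] ℂ)) (fun i => ⟨v i, by simp [hv]⟩)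
  have hpos : 0 < ∏ i, ‖inner ℂ (v i) z‖ ^ n i := by
    by_contra! hle
    have h1 : 0 < ∏ i, ‖inner ℂ (v i) x‖ ^ n i :=
      Finset.prod_pos fun i _ => pow_pos (norm_pos_iff.2 (hx i)) _
    have h2 := mul_nonpos_of_nonpos_of_nonneg hle (pow_nonneg (norm_nonneg x) (∑ i, n i))
    linarith [hmax' x]
  refine ⟨z, by simpa using hz, weight_le_mul_norm_inner_sq_of_isMaxOn hv (by simpa using hz)
    (fun i h0 => ?_) hmax'⟩
  refine hpos.ne' (Finset.prod_eq_zero (Finset.mem_univ i) ?_)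
  simp [h0, (hn i).ne']

/-- The **complex plank theorem** for finitely many unit vectors, with strict inequality for the sum
of the squared widths. -/
theorem exists_le_norm_inner {ι E : Type*} [Fintype ι] [NormedAddCommGroup E]
    [InnerProductSpace ℂ E] [FiniteDimensional ℂ E] {v : ι → E} (hv : ∀ i, ‖v i‖ = 1)
    {t : ι → ℝ} (ht : ∑ i, t i ^ 2 < 1) :
    ∃ z : E, ‖z‖ ≤ 1 ∧ ∀ i, t i ≤ ‖inner ℂ (v i) z‖ := by
  rcases isEmpty_or_nonempty ι with hι | hι
  · exact ⟨0, by simp, fun i => isEmptyElim i⟩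
  set S := ∑ i, t i ^ 2 with hS
  -- The integer weights `⌊M * t i ^ 2⌋₊ + 1` have sum at most `M * S + card ι`, which is below `M`
  -- for large `M`.
  obtain ⟨M, hM⟩ := exists_nat_gt ((Fintype.card ι : ℕ) / (1 - S))
  have hM' : (Fintype.card ι : ℕ) < M * (1 - S) := (div_lt_iff₀ (by linarith)).1 hM
  have hcard : (0 : ℝ) < (Fintype.card ι : ℕ) := by exact_mod_cast Fintype.card_pos
  obtain ⟨z, hz, hzn⟩ := exists_weight_le_mul_norm_inner_sq hv
    (n := fun i => ⌊M * t i ^ 2⌋₊ + 1) (fun i => Nat.succ_pos _)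
  have hMpos : (0 : ℝ) < M := by nlinarith
  have hsum : ((∑ i, (⌊M * t i ^ 2⌋₊ + 1) : ℕ) : ℝ) ≤ M := by
    push_cast
    rw [Finset.sum_add_distrib]
    have h1 : ∑ i, (⌊M * t i ^ 2⌋₊ : ℝ) ≤ ∑ i, M * t i ^ 2 :=
      Finset.sum_le_sum fun i _ => Nat.floor_le (by positivity)
    rw [← Finset.mul_sum, ← hS] at h1
    simp only [Finset.sum_const, Finset.card_univ, nsmul_eq_mul, mul_one]
    linarith
  refine ⟨z, hz.le, fun i => ?_⟩
  have h1 := hzn i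
  have h2 : M * t i ^ 2 < (⌊M * t i ^ 2⌋₊ + 1 : ℕ) := by exact_mod_cast Nat.lt_floor_add_one _
  have h3 : M * t i ^ 2 ≤ M * ‖inner ℂ (v i) z‖ ^ 2 :=
    h2.le.trans (h1.trans (mul_le_mul_of_nonneg_right hsum (by positivity)))
  exact le_of_abs_le (by simpa using sq_le_sq.1 (le_of_mul_le_mul_left h3 hMpos))

/-! ### Lower bounds for families of functionals and operators -/

/-- A plank theorem for functionals on a real Banach space. The vector found is
`∑ j, √(p j) * ν j • x j` for some `ν` in `ℓ²`. -/
theorem exists_half_mul_le_abs_apply {ι X : Type*} [NormedAddCommGroup X] [NormedSpace ℝ X]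
    [CompleteSpace X] {φ : ι → StrongDual ℝ X} {x : ι → X} (hx : ∀ i, ‖x i‖ ≤ 1) {r : ι → ℝ}
    (hr : ∀ i, 0 < r i) (hφ : ∀ i, r i ≤ φ i (x i)) {p : ι → ℝ} (hp : ∀ i, 0 < p i)
    (hps : Summable p) : ∃ z : X, ∀ i, r i * p i / 2 ≤ |φ i z| := by
  classical
  have hφx : ∀ i j, |φ i (x j)| ≤ ‖φ i‖ := fun i j =>
    (φ i).le_of_opNorm_le_of_le le_rfl (hx j) |>.trans_eq (mul_one _)
  -- The vectors `u i` below represent the functionals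
  -- `ν ↦ φ i (∑ j, √(p j) * ν j • x j)`, divided by `r i * √(p i)` so that `⟪u i, e i⟫ ≥ 1`.
  have hmem : ∀ i, Memℓp (fun j => √(p j) * φ i (x j) / (r i * √(p i))) 2 := by
    intro i
    have h := (hps.mul_right (‖φ i‖ ^ 2)).div_const ((r i * √(p i)) ^ 2)
    refine memℓp_gen (Summable.of_nonneg_of_le (fun j => by positivity) (fun j => ?_) h)
    have h1 : |φ i (x j)| ^ 2 ≤ ‖φ i‖ ^ 2 := pow_le_pow_left₀ (abs_nonneg _) (hφx i j) 2
    simp only [ENNReal.toReal_ofNat, Real.rpow_ofNat, Real.norm_eq_abs, sq_abs, div_pow, mul_pow,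
      Real.sq_sqrt (hp j).le] at h1 ⊢
    gcongr
    exact (hp j).le
  let u : ι → lp (fun _ : ι => ℝ) 2 := fun i => ⟨_, hmem i⟩
  let e : ι → lp (fun _ : ι => ℝ) 2 := fun i => lp.single 2 i 1
  have he : Orthonormal ℝ e := by
    rw [orthonormal_iff_ite]
    intro i j
    simp [e, lp.inner_single_left, lp.single_apply, Pi.single_apply]
  obtain ⟨ν, hν⟩ := he.exists_half_le_abs_inner (u := u) (s := fun i => √(p i)) (fun i => by
    have := Real.sqrt_pos.2 (hp i)
    have hri := hr i
    simp only [u, e, lp.inner_single_right]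
    simp
    rw [mul_comm, mul_div_mul_right _ _ this.ne', one_le_div hri]
    exact hφ i) (by simpa only [Real.sq_sqrt (hp _).le] using hps)
  have hν2 : Summable fun j => ν j ^ 2 := by
    have := (lp.memℓp ν).summable (by simp)
    simpa using this
  have hsum : Summable fun j => (√(p j) * ν j) • x j := by
    refine Summable.of_norm_bounded ((hps.add hν2).div_const 2) fun j => ?_
    rw [norm_smul, norm_mul, Real.norm_of_nonneg (Real.sqrt_nonneg _), Real.norm_eq_abs]
    have h1 := Real.sq_sqrt (hp j).le
    have h2 := sq_abs (ν j)
    calc √(p j) * |ν j| * ‖x j‖ ≤ √(p j) * |ν j| * 1 := by gcongr; exact hx j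
      _ ≤ (p j + ν j ^ 2) / 2 := by nlinarith [sq_nonneg (√(p j) - |ν j|)]
  refine ⟨∑' j, (√(p j) * ν j) • x j, fun i => ?_⟩
  have hi := Real.sqrt_pos.2 (hp i)
  have hc : 0 < r i * √(p i) := mul_pos (hr i) hi
  have hval : φ i (∑' j, (√(p j) * ν j) • x j) = r i * √(p i) * ⟪u i, ν⟫ := by
    rw [(φ i).map_tsum hsum, lp.inner_eq_tsum, ← tsum_mul_left]
    refine tsum_congr fun j => ?_
    simp only [map_smul, smul_eq_mul, u, RCLike.inner_apply, conj_trivial]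
    have := (hr i).ne'
    field_simp
  rw [hval, abs_mul, abs_of_pos hc]
  calc r i * p i / 2 = r i * √(p i) * (√(p i) / 2) := by
        nth_rewrite 1 [← Real.mul_self_sqrt (hp i).le]; ring
    _ ≤ _ := by gcongr; exact hν i

theorem ContinuousLinearMap.exists_half_norm_le_norm_apply {𝕜 X Y : Type*} [RCLike 𝕜]
    [NormedAddCommGroup X] [NormedSpace 𝕜 X] [NormedAddCommGroup Y] [NormedSpace 𝕜 Y]
    (T : X →L[𝕜] Y) : ∃ x : X, ‖x‖ ≤ 1 ∧ ‖T‖ / 2 ≤ ‖T x‖ := by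
  rcases eq_or_ne T 0 with rfl | hT
  · exact ⟨0, by simp⟩
  · obtain ⟨x, hx, h⟩ := T.exists_lt_apply_of_lt_opNorm (half_lt_self (norm_pos_iff.2 hT))
    exact ⟨x, hx.le, h.le⟩

/-- The complex case follows from the real one, applied to the real parts of functionals. -/
theorem exists_mul_norm_le_norm_apply {ι 𝕜 X Y : Type*} [RCLike 𝕜] [NormedAddCommGroup X]
    [NormedSpace 𝕜 X] [CompleteSpace X] [NormedAddCommGroup Y] [NormedSpace 𝕜 Y]
    {T : ι → X →L[𝕜] Y} (hT : ∀ i, T i ≠ 0) {p : ι → ℝ} (hp : ∀ i, 0 < p i) (hps : Summable p) :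
    ∃ z : X, ∀ i, p i * ‖T i‖ / 4 ≤ ‖T i z‖ := by
  let _ : NormedSpace ℝ X := NormedSpace.restrictScalars ℝ 𝕜 X
  have _ : IsScalarTower ℝ 𝕜 X := RestrictScalars.isScalarTower ℝ 𝕜 X
  choose x hx hTx using fun i => (T i).exists_half_norm_le_norm_apply
  choose g hg hgT using fun i => exists_dual_vector'' 𝕜 (T i (x i))
  obtain ⟨z, hz⟩ := exists_half_mul_le_abs_apply
    (φ := fun i => RCLike.reCLM.comp (((g i).comp (T i)).restrictScalars ℝ)) hx
    (r := fun i => ‖T i‖ / 2) (fun i => half_pos (norm_pos_iff.2 (hT i)))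
    (fun i => by simpa [hgT] using hTx i) hp hps
  refine ⟨z, fun i => ?_⟩
  calc p i * ‖T i‖ / 4 = ‖T i‖ / 2 * p i / 2 := by ring
    _ ≤ _ := hz i
    _ ≤ ‖g i (T i z)‖ := RCLike.abs_re_le_norm _
    _ ≤ 1 * ‖T i z‖ := (g i).le_of_opNorm_le (hg i) _
    _ = ‖T i z‖ := one_mul _

/-- In a complex Hilbert space square summability of the weights is enough. The constant `c` depends
on the sum of their squares. -/
theorem exists_mul_norm_le_norm_apply_of_summable_sq {ι X Y : Type*} [NormedAddCommGroup X]
    [InnerProductSpace ℂ X] [CompleteSpace X] [NormedAddCommGroup Y] [NormedSpace ℂ Y]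
    {T : ι → X →L[ℂ] Y} (hT : ∀ i, T i ≠ 0) {t : ι → ℝ} (hts : Summable fun i => t i ^ 2) :
    ∃ c > 0, ∃ z : X, ∀ i, c * t i * ‖T i‖ ≤ ‖T i z‖ := by
  set S := ∑' i, t i ^ 2 with hS
  have hS0 : 0 ≤ S := tsum_nonneg fun i => sq_nonneg _
  set c := (√(S + 1))⁻¹ with hc
  have hc0 : 0 < c := inv_pos.2 (Real.sqrt_pos.2 (by linarith))
  have hc2 : c ^ 2 = (S + 1)⁻¹ := by rw [hc, inv_pow, Real.sq_sqrt (by linarith)]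
  choose x hx hTx using fun i => (T i).exists_half_norm_le_norm_apply
  choose g hg hgT using fun i => exists_dual_vector'' ℂ (T i (x i))
  let w : ι → X := fun i => (InnerProductSpace.toDual ℂ X).symm ((g i).comp (T i))
  have hw : ∀ i y, inner ℂ (w i) y = g i (T i y) := fun i y => by
    simp [w, InnerProductSpace.toDual_symm_apply]
  have hwn : ∀ i, ‖T i‖ / 2 ≤ ‖w i‖ := by
    intro i
    calc ‖T i‖ / 2 ≤ ‖T i (x i)‖ := hTx i
      _ = ‖inner ℂ (w i) (x i)‖ := by rw [hw, hgT]; simp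
      _ ≤ ‖w i‖ * ‖x i‖ := norm_inner_le_norm _ _
      _ ≤ ‖w i‖ := mul_le_of_le_one_right (norm_nonneg _) (hx i)
  have hw0 : ∀ i, 0 < ‖w i‖ := fun i => (half_pos (norm_pos_iff.2 (hT i))).trans_le (hwn i)
  obtain ⟨z, -, hz⟩ := exists_le_norm_inner_of_finset (𝕜 := ℂ)
    (fun i => ((‖w i‖⁻¹ : ℝ) : ℂ) • w i) (fun i => c * t i) 1 (by
      intro F
      let E : Submodule ℂ X := Submodule.span ℂ (w '' F)
      have : FiniteDimensional ℂ E := FiniteDimensional.span_of_finite ℂ (F.finite_toSet.image w)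
      have hwE : ∀ i : F, ((‖w i‖⁻¹ : ℝ) : ℂ) • w i ∈ E := fun i =>
        E.smul_mem _ (Submodule.subset_span ⟨i, i.2, rfl⟩)
      obtain ⟨z, hz, hzF⟩ := exists_le_norm_inner (ι := F) (E := E)
        (v := fun i => ⟨((‖w i‖⁻¹ : ℝ) : ℂ) • w i, hwE i⟩)
        (fun i => by simp [norm_smul, (hw0 i).ne'])
        (t := fun i => c * t i) (by
          have h1 : ∑ i ∈ F, t i ^ 2 ≤ S := hts.sum_le_tsum F fun i _ => sq_nonneg _
          rw [Finset.sum_coe_sort F fun i => (c * t i) ^ 2]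
          simp only [mul_pow]
          rw [← Finset.mul_sum, hc2, inv_mul_lt_iff₀ (by linarith)]
          linarith)
      exact ⟨z, hz, fun i hi => hzF ⟨i, hi⟩⟩)
  refine ⟨c / 2, half_pos hc0, z, fun i => ?_⟩
  have h1 := hz i
  rw [inner_smul_left, norm_mul, hw] at h1
  simp only [Complex.conj_ofReal, Complex.norm_real, norm_inv, norm_norm] at h1
  rw [le_inv_mul_iff₀ (hw0 i)] at h1
  have h2 : ‖g i (T i z)‖ ≤ ‖T i z‖ := by simpa using (g i).le_of_opNorm_le (hg i) (T i z)
  rcases le_total (t i) 0 with h | h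
  · exact (mul_nonpos_of_nonpos_of_nonneg (mul_nonpos_of_nonneg_of_nonpos (by positivity) h)
      (norm_nonneg _)).trans (norm_nonneg _)
  · calc c / 2 * t i * ‖T i‖ = ‖T i‖ / 2 * (c * t i) := by ring
      _ ≤ ‖w i‖ * (c * t i) := by gcongr; exact hwn i
      _ ≤ _ := h1.trans h2

/-! ### Orbits tending to infinity -/

theorem summable_of_tsum_one_div_enorm_pow_lt_top {E : Type*} [NormedAddCommGroup E]
    {a : ℕ → E} {m : ℕ} (hm : m ≠ 0) (h : ∑' k, 1 / ‖a k‖ₑ ^ m < ⊤) :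
    (∀ k, a k ≠ 0) ∧ Summable fun k => (‖a k‖ ^ m)⁻¹ := by
  have h0 : ∀ k, a k ≠ 0 := by
    intro k hk
    refine (ENNReal.ne_top_of_tsum_ne_top h.ne k) ?_
    simp [hk, hm]
  refine ⟨h0, ?_⟩
  have := ENNReal.summable_toReal h.ne
  simpa using this

theorem summable_prod_of_forall_summable {N : ℕ} {f : Fin N × ℕ → ℝ} (hf : ∀ i, 0 ≤ f i)
    (h : ∀ j, Summable fun k => f (j, k)) : Summable f :=
  (summable_prod_of_nonneg hf).2 ⟨h, Summable.of_finite⟩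

/-- The index `k` runs through `ℕ` from `0`. The sums are taken in `[0, ∞]`, where `1 / 0 = ∞`, so
the hypotheses say that no `T j k` vanishes and that the series of the real numbers
`1 / ‖T j k‖` in (i), `1 / ‖T j k‖ ^ 2` in (ii), converges. -/
theorem proposition4p8 :
    -- (i) Banach spaces over the real or complex numbers
    (∀ (𝕜 : Type*) [RCLike 𝕜]
      (X : Type*) [NormedAddCommGroup X] [NormedSpace 𝕜 X] [CompleteSpace X]
      (Y : Type*) [NormedAddCommGroup Y] [NormedSpace 𝕜 Y] [CompleteSpace Y]
      (N : ℕ) (T : Fin N → ℕ → X →L[𝕜] Y),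
      (∀ j : Fin N, ∑' k : ℕ, 1 / ‖T j k‖ₑ < ⊤) →
      ∃ x : X, ∀ j : Fin N, Filter.Tendsto (fun k : ℕ => ‖T j k x‖) Filter.atTop Filter.atTop) ∧
    -- (ii) `X` is a complex Hilbert space
    (∀ (X : Type*) [NormedAddCommGroup X] [InnerProductSpace ℂ X] [CompleteSpace X]
      (Y : Type*) [NormedAddCommGroup Y] [NormedSpace ℂ Y] [CompleteSpace Y]
      (N : ℕ) (T : Fin N → ℕ → X →L[ℂ] Y),
      (∀ j : Fin N, ∑' k : ℕ, 1 / ‖T j k‖ₑ ^ 2 < ⊤) →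
      ∃ x : X, ∀ j : Fin N, Filter.Tendsto (fun k : ℕ => ‖T j k x‖) Filter.atTop Filter.atTop) := by
  constructor
  · intro 𝕜 _ X _ _ _ Y _ _ _ N T hT
    have h := fun j => summable_of_tsum_one_div_enorm_pow_lt_top (a := T j) one_ne_zero
      (by simpa using hT j)
    simp only [pow_one] at h
    have hpos : ∀ j k, 0 < ‖T j k‖ := fun j k => norm_pos_iff.2 ((h j).1 k)
    choose a ha0 hatop has using fun j =>
      exists_tendsto_atTop_summable_mul (fun k => inv_pos.2 (hpos j k)) (h j).2
    obtain ⟨x, hx⟩ := exists_mul_norm_le_norm_apply (T := fun i : Fin N × ℕ => T i.1 i.2)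
      (fun i => (h i.1).1 i.2) (p := fun i => a i.1 i.2 * ‖T i.1 i.2‖⁻¹)
      (fun i => mul_pos (ha0 _ _) (inv_pos.2 (hpos _ _)))
      (summable_prod_of_forall_summable
        (fun i => (mul_pos (ha0 _ _) (inv_pos.2 (hpos _ _))).le) has)
    refine ⟨x, fun j => Filter.tendsto_atTop_mono (fun k => ?_)
      ((hatop j).atTop_div_const (show (0 : ℝ) < 4 by norm_num))⟩
    have := hx (j, k)
    simpa [mul_assoc, (hpos j k).ne'] using this
  · intro X _ _ _ Y _ _ _ N T hT
    have h := fun j => summable_of_tsum_one_div_enorm_pow_lt_top (a := T j) two_ne_zero (hT j)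
    have hpos : ∀ j k, 0 < ‖T j k‖ := fun j k => norm_pos_iff.2 ((h j).1 k)
    choose a ha0 hatop has using fun j => exists_tendsto_atTop_summable_mul
      (fun k => inv_pos.2 (pow_pos (hpos j k) 2)) (h j).2
    have hsq : ∀ j k, (√(a j k) * ‖T j k‖⁻¹) ^ 2 = a j k * (‖T j k‖ ^ 2)⁻¹ := fun j k => by
      rw [mul_pow, Real.sq_sqrt (ha0 j k).le, inv_pow]
    obtain ⟨c, hc, x, hx⟩ := exists_mul_norm_le_norm_apply_of_summable_sq
      (T := fun i : Fin N × ℕ => T i.1 i.2) (fun i => (h i.1).1 i.2)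
      (t := fun i => √(a i.1 i.2) * ‖T i.1 i.2‖⁻¹)
      (summable_prod_of_forall_summable (fun i => sq_nonneg _) fun j => by
        simpa only [hsq] using has j)
    refine ⟨x, fun j => Filter.tendsto_atTop_mono (fun k => ?_)
      ((Real.tendsto_sqrt_atTop.comp (hatop j)).const_mul_atTop hc)⟩
    have := hx (j, k)
    simpa [mul_assoc, (hpos j k).ne'] using this
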